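/- Let $K$ be a field, $s\ge 1$, $S=K[t_1,\ldots,t_s]$, and let $L$ be an $s\times m$ integer matrix whose columns generate the subgroup $\mathcal L\subset\mathbb Z^s$. Write $a=a^+-a^-$ for $a\in\mathbb Z^s$, with $a^+,a^-\in\mathbb N^s$ of disjoint support, and let $I(\mathcal L)=(t^{a^+}-t^{a^-}\mid a\in\mathcal L)\subset S$ be the lattice ideal of $\mathcal L$. Let $PLQ=\Gamma$ be a normal decomposition of $L$: $P=(p_{i,j})$ and $Q$ are invertible integer matrices and $\Gamma=\mathrm{diag}(\gamma_1,\ldots,\gamma_r,0,\ldots,0)$ is an $s\times m$ matrix with all $\gamma_i$ positive integers and $\gamma_i\mid\gamma_j$ for $i\le j$. Suppose that $I(\mathcal L)$ is graded with respect to a grading $\deg t_i=d_i$, where $d_1,\ldots,d_s$ are positive integers with $\gcd(d_1,\ldots,d_s)=1$, and that $S/I(\mathcal L)$ has Krull dimension $1$. Suppose also that, if $r\ge 1$, the field $K$ contains the $\gamma_r$-th roots of unity (that is, $z^{\gamma_r}-1$ splits into linear factors over $K$) and $\mathrm{char}(K)\nmid\gamma_r$ (this holds automatically if $\mathrm{char}(K)=0$).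 Let $\Lambda=\prod_{i=1}^{r}\Lambda_i$, where $\Lambda_i$ is the set of $\gamma_i$-th roots of unity in $K$, and for $\lambda=(\lambda_1,\ldots,\lambda_r)\in\Lambda$ let $\mathfrak a_\lambda$ be the kernel of the homomorphism of $K$-algebras $$\varphi_\lambda\colon S\to K[x_1],\qquad t_j\mapsto \lambda_1^{p_{1,j}}\cdots\lambda_r^{p_{r,j}}\,x_1^{d_j}\quad(j=1,\ldots,s).$$ Put $\gamma=\gamma_1\cdots\gamma_r$. Then $r=s-1$ (so that $\gamma_r=\gamma_{s-1}$ if $s\ge 2$), the ideals $\mathfrak a_\lambda$ ($\lambda\in\Lambda$) are prime and pairwise distinct, $$I(\mathcal L)=\bigcap_{\lambda\in\Lambda}\mathfrak a_\lambda,$$ this is a minimal primary decomposition of $I(\mathcal L)$ and the only one, and it has exactly $\gamma=|T(\mathbb Z^s/\mathcal L)|$ components, where $T(\cdot)$ denotes the torsion subgroup. -/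

import Mathlib

open MvPolynomial

noncomputable section

/-- The positive part `a⁺ ∈ ℕ^s` of `a ∈ ℤ^s`, as an exponent vector; the negative part
`a⁻` is `expPos (-a)`, so that `a = a⁺ - a⁻` with `a⁺`, `a⁻` of disjoint support. -/
def expPos {s : ℕ} (a : Fin s → ℤ) : Fin s →₀ ℕ :=
  Finsupp.equivFunOnFinite.symm fun i => (a i).toNat

/-- The lattice ideal `I(𝓛) = (t^{a⁺} - t^{a⁻} | a ∈ 𝓛)` of `K[t_1, …, t_s]`. -/
def latticeIdeal (K : Type*) [Field K] {s : ℕ} (𝓛 : AddSubgroup (Fin s → ℤ)) :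
    Ideal (MvPolynomial (Fin s) K) :=
  Ideal.span {f | ∃ a ∈ 𝓛, f = monomial (expPos a) 1 - monomial (expPos (-a)) 1}

/-- The ideal `I` of `K[t_1, …, t_s]` is graded for the grading with `deg t_i = d_i`. -/
def IsGradedFor {K : Type*} [Field K] {s : ℕ} (d : Fin s → ℕ)
    (I : Ideal (MvPolynomial (Fin s) K)) : Prop :=
  letI := weightedGradedAlgebra K d
  I.IsHomogeneous (weightedHomogeneousSubmodule K d)

/-- The `s × m` matrix `diag(γ_1, …, γ_r, 0, …, 0)`. -/
def diagMatrix (s m : ℕ) {r : ℕ} (γ : Fin r → ℕ) : Matrix (Fin s) (Fin m) ℤ :=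
  Matrix.of fun i j =>
    if h : (i : ℕ) = (j : ℕ) ∧ (i : ℕ) < r then (γ ⟨i, h.2⟩ : ℤ) else 0

/-- `P L Q = Γ` is a normal decomposition of the integer matrix `L`: `P` and `Q` are invertible
integer matrices and `Γ = diag(γ_1, …, γ_r, 0, …, 0)` is the Smith normal form of `L`. -/
structure IsNormalDecomposition {s m r : ℕ} (L : Matrix (Fin s) (Fin m) ℤ)
    (P : Matrix (Fin s) (Fin s) ℤ) (Q : Matrix (Fin m) (Fin m) ℤ) (γ : Fin r → ℕ) : Prop where
  isUnit_left : IsUnit P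
  isUnit_right : IsUnit Q
  le_rows : r ≤ s
  le_cols : r ≤ m
  pos : ∀ i, 0 < γ i
  dvd : ∀ i j, i ≤ j → γ i ∣ γ j
  eq : P * L * Q = diagMatrix s m γ

/-- The `K`-algebra homomorphism
`φ_λ : K[t_1, …, t_s] → K[x_1]`, `t_j ↦ λ_1^{p_{1,j}} ⋯ λ_r^{p_{r,j}} x_1^{d_j}`,
where `λ_i` runs over the `γ_i`-th roots of unity in `K`. -/
def phi {K : Type*} [Field K] {s r : ℕ} (hrs : r ≤ s) (P : Matrix (Fin s) (Fin s) ℤ)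
    (d : Fin s → ℕ) {γ : Fin r → ℕ} (lam : (i : Fin r) → rootsOfUnity (γ i) K) :
    MvPolynomial (Fin s) K →ₐ[K] Polynomial K :=
  aeval fun j =>
    Polynomial.C ((∏ i : Fin r, (lam i : Kˣ) ^ P (Fin.castLE hrs i) j : Kˣ) : K) *
      Polynomial.X ^ d j

/-- The ideal `𝔞_λ = ker φ_λ`. -/
def aIdeal {K : Type*} [Field K] {s r : ℕ} (hrs : r ≤ s) (P : Matrix (Fin s) (Fin s) ℤ)
    (d : Fin s → ℕ) {γ : Fin r → ℕ} (lam : (i : Fin r) → rootsOfUnity (γ i) K) :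
    Ideal (MvPolynomial (Fin s) K) :=
  RingHom.ker (phi hrs P d lam)

end

noncomputable section

open Matrix

/-! In the coordinates `P a`, the lattice is cut out by `γ i ∣ (P a)_i` for the first `r` entries
and `(P a)_i = 0` for the others. Gradedness makes `d` orthogonal to it. If `r = s`, this forces `d
= 0`; if `r + 2 ≤ s`, a second independent form gives a chain of three primes, against dimension 1.
So `r + 1 = s`, and the lattice is given by `d ⬝ᵥ a = 0` and the divisibilities
(`mem_closure_iff_dotProduct`).

`φ_λ` sends `t^u` to `χ_λ(u) x^{d·u}` for a character `χ_λ`. If all `φ_λ` kill `f`, multiplying the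
coefficient equations in one degree by `χ_λ(v)⁻¹` and summing over `λ` gives, by orthogonality, `∏ γ
i` times the sum of the coefficients of `f` over the class of `v`. As `∏ γ i ≠ 0` in `K`, these sums
vanish, so `f` lies in the lattice ideal (`latticeIdeal_eq_iInf`).

Twisted binomials separate the kernels (`eq_of_aIdeal_le`), and an intersection of incomparable
primes has only one minimal primary decomposition. -/

/-! ### Lattices in Smith coordinates -/

theorem mem_range_mulVec_diagMatrix_iff {s m r : ℕ} {γ : Fin r → ℕ} (hrs : r ≤ s) (hrm : r ≤ m)
    (b : Fin s → ℤ) :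
    (∃ w, diagMatrix s m γ *ᵥ w = b) ↔
      (∀ i : Fin r, (γ i : ℤ) ∣ b (Fin.castLE hrs i)) ∧ ∀ i : Fin s, r ≤ i → b i = 0 := by
  have key (w : Fin m → ℤ) (i : Fin s) : (diagMatrix s m γ *ᵥ w) i =
      if h : (i : ℕ) < r then (γ ⟨i, h⟩ : ℤ) * w ⟨i, h.trans_le hrm⟩ else 0 := by
    simp only [mulVec, dotProduct, diagMatrix, Matrix.of_apply]
    split_ifs with h
    · rw [Finset.sum_eq_single ⟨i, h.trans_le hrm⟩]
      · simp [h]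
      · intro j _ hj
        rw [dif_neg, zero_mul]
        exact fun h' => hj (Fin.ext h'.1.symm)
      · simp
    · exact Finset.sum_eq_zero fun j _ => by rw [dif_neg (fun h' => h h'.2), zero_mul]
  constructor
  · rintro ⟨w, rfl⟩
    refine ⟨fun i => ?_, fun i hi => ?_⟩
    · rw [key]; simp
    · rw [key, dif_neg (not_lt.2 hi)]
  · rintro ⟨h1, h2⟩
    choose q hq using h1
    refine ⟨fun j => if h : (j : ℕ) < r then q ⟨j, h⟩ else 0, funext fun i => ?_⟩
    rw [key]
    split_ifs with h
    · simpa [h] using (hq ⟨i, h⟩).symm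
    · exact (h2 i (not_lt.1 h)).symm

theorem IsNormalDecomposition.mem_closure_iff {s m r : ℕ} {L : Matrix (Fin s) (Fin m) ℤ}
    {P : Matrix (Fin s) (Fin s) ℤ} {Q : Matrix (Fin m) (Fin m) ℤ} {γ : Fin r → ℕ}
    (hN : IsNormalDecomposition L P Q γ) (a : Fin s → ℤ) :
    a ∈ AddSubgroup.closure (Set.range L.col) ↔
      (∀ i : Fin r, (γ i : ℤ) ∣ (P *ᵥ a) (Fin.castLE hN.le_rows i)) ∧
        ∀ i : Fin s, r ≤ i → (P *ᵥ a) i = 0 := by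
  rw [← mem_range_mulVec_diagMatrix_iff hN.le_rows hN.le_cols, ← hN.eq,
    ← Submodule.span_int_eq_addSubgroupClosure, Submodule.mem_toAddSubgroup,
    ← Matrix.range_mulVecLin, LinearMap.mem_range]
  simp only [Matrix.mulVecLin_apply, ← Matrix.mulVec_mulVec]
  constructor
  · rintro ⟨v, rfl⟩
    refine ⟨Q⁻¹ *ᵥ v, ?_⟩
    rw [Matrix.mulVec_mulVec v Q, Matrix.mul_nonsing_inv _ ((Matrix.isUnit_iff_isUnit_det _).1
      hN.isUnit_right), Matrix.one_mulVec]
  · rintro ⟨w, hw⟩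
    exact ⟨_, Matrix.mulVec_injective_of_isUnit hN.isUnit_left hw⟩

theorem IsNormalDecomposition.mulVec_inv_mulVec {s m r : ℕ} {L : Matrix (Fin s) (Fin m) ℤ}
    {P : Matrix (Fin s) (Fin s) ℤ} {Q : Matrix (Fin m) (Fin m) ℤ} {γ : Fin r → ℕ}
    (hN : IsNormalDecomposition L P Q γ) (b : Fin s → ℤ) : P *ᵥ (P⁻¹ *ᵥ b) = b := by
  rw [Matrix.mulVec_mulVec, Matrix.mul_nonsing_inv _ ((Matrix.isUnit_iff_isUnit_det _).1
      hN.isUnit_left), Matrix.one_mulVec]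

/-- A linear form vanishing on the lattice is a combination of the rows of `P` beyond the rank. -/
theorem IsNormalDecomposition.exists_coeff {s m r : ℕ} {L : Matrix (Fin s) (Fin m) ℤ}
    {P : Matrix (Fin s) (Fin s) ℤ} {Q : Matrix (Fin m) (Fin m) ℤ} {γ : Fin r → ℕ}
    (hN : IsNormalDecomposition L P Q γ) (d : Fin s → ℤ)
    (hd : ∀ a ∈ AddSubgroup.closure (Set.range L.col), d ⬝ᵥ a = 0) :
    ∃ c : Fin s → ℤ, (∀ i : Fin s, (i : ℕ) < r → c i = 0) ∧ ∀ a, d ⬝ᵥ a = c ⬝ᵥ (P *ᵥ a) := by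
  have hc (a : Fin s → ℤ) : d ⬝ᵥ a = (d ᵥ* P⁻¹) ⬝ᵥ (P *ᵥ a) := by
    rw [← Matrix.dotProduct_mulVec, Matrix.mulVec_mulVec, Matrix.nonsing_inv_mul _
      ((Matrix.isUnit_iff_isUnit_det _).1 hN.isUnit_left), Matrix.one_mulVec]
  refine ⟨d ᵥ* P⁻¹, fun i hi => ?_, hc⟩
  -- This lattice vector pairs with `d` to `c i * γ i`.
  have hmem : P⁻¹ *ᵥ Pi.single i (γ ⟨i, hi⟩ : ℤ) ∈ AddSubgroup.closure (Set.range L.col) := by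
    rw [hN.mem_closure_iff, hN.mulVec_inv_mulVec]
    refine ⟨fun j => ?_, fun j hj => ?_⟩
    · by_cases h : Fin.castLE hN.le_rows j = i
      · subst h; simp
      · simp [Pi.single_eq_of_ne h]
    · rw [Pi.single_eq_of_ne]
      rintro rfl; omega
  have := hd _ hmem
  rw [hc, hN.mulVec_inv_mulVec, dotProduct_single] at this
  exact (mul_eq_zero.1 this).resolve_right (by exact_mod_cast (hN.pos _).ne')

/-- If the lattice has corank at least two, then any linear form `d` vanishing on it can be
complemented by an independent one. -/
theorem IsNormalDecomposition.exists_independent {s m r : ℕ} {L : Matrix (Fin s) (Fin m) ℤ}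
    {P : Matrix (Fin s) (Fin s) ℤ} {Q : Matrix (Fin m) (Fin m) ℤ} {γ : Fin r → ℕ}
    (hN : IsNormalDecomposition L P Q γ) (hr : r + 2 ≤ s) (d : Fin s → ℤ)
    (hd : ∀ a ∈ AddSubgroup.closure (Set.range L.col), d ⬝ᵥ a = 0) :
    ∃ e u : Fin s → ℤ, (∀ a ∈ AddSubgroup.closure (Set.range L.col), e ⬝ᵥ a = 0) ∧
      d ⬝ᵥ u = 0 ∧ e ⬝ᵥ u ≠ 0 := by
  obtain ⟨c, -, hc⟩ := hN.exists_coeff d hd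
  have hrow (i : Fin s) (hi : r ≤ i) :
      ∀ a ∈ AddSubgroup.closure (Set.range L.col), P i ⬝ᵥ a = 0 :=
    fun a ha => ((hN.mem_closure_iff a).1 ha).2 i hi
  have hPw (i : Fin s) (b : Fin s → ℤ) : P i ⬝ᵥ (P⁻¹ *ᵥ b) = b i :=
    congrFun (hN.mulVec_inv_mulVec b) i
  set i : Fin s := ⟨r, by omega⟩ with hi
  set j : Fin s := ⟨r + 1, by omega⟩ with hj
  have hij : i ≠ j := by simp [hi, hj]
  -- In `P`-coordinates `d` is `c`; it kills `e_i` if `c i = 0`, and always kills `c_j e_i - c_i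
  -- e_j`, on which row `j` takes the value `-c i`.
  by_cases h : c i = 0
  · refine ⟨P i, P⁻¹ *ᵥ Pi.single i 1, hrow i le_rfl, ?_, ?_⟩
    · rw [hc, hN.mulVec_inv_mulVec]; simp [h]
    · rw [hPw]; simp
  · refine ⟨P j, P⁻¹ *ᵥ (Pi.single i (c j) - Pi.single j (c i)), hrow j (by simp [hj]), ?_, ?_⟩
    · rw [hc, hN.mulVec_inv_mulVec, dotProduct_sub]; simp [mul_comm]
    · rw [hPw]; simp [Pi.single_eq_of_ne hij.symm, h]

/-! ### Primary decomposition, dimension and roots of unity -/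

theorem isMinimalPrimaryDecomposition_inf_of_isPrime {R : Type*} [CommRing R]
    {t : Finset (Ideal R)} (hp : ∀ p ∈ t, p.IsPrime) (hinc : ∀ p ∈ t, ∀ q ∈ t, p ≤ q → p = q) :
    Submodule.IsMinimalPrimaryDecomposition (t.inf id) t := by
  refine ⟨rfl, fun p hpt => (hp p hpt).isPrimary, fun p hpt q hqt hpq => ?_, fun p hpt h => ?_⟩
  · simpa [Function.onFun, (hp p hpt).radical, (hp q hqt).radical] using hpq
  · obtain ⟨q, hq, hqp⟩ := (hp p hpt).inf_le'.1 h
    exact (Finset.mem_erase.1 hq).1 (hinc q (Finset.mem_of_mem_erase hq) p hpt hqp)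

/-- A finite intersection of pairwise incomparable primes has a unique minimal primary
decomposition. -/
theorem eq_of_isMinimalPrimaryDecomposition_inf {R : Type*} [CommRing R]
    {t t' : Finset (Ideal R)} (hp : ∀ p ∈ t, p.IsPrime)
    (hinc : ∀ p ∈ t, ∀ q ∈ t, p ≤ q → p = q)
    (ht' : Submodule.IsMinimalPrimaryDecomposition (t.inf id) t') : t' = t := by
  have hle (q) (hq : q ∈ t') : t.inf id ≤ q := ht'.inf_eq ▸ Finset.inf_le (f := id) hq
  have hsub : t ⊆ t' := by
    intro p hpt
    obtain ⟨q, hq, hqp⟩ : ∃ q : Ideal R, q ∈ t' ∧ q ≤ p := (hp p hpt).inf_le'.1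
      (ht'.inf_eq.trans_le (Finset.inf_le (f := id) hpt))
    have hqprim : Ideal.IsPrimary q := ht'.primary hq
    -- The prime `q.radical` contains some `p' ∈ t`, and `p' ≤ q.radical ≤ p` collapses by
    -- incomparability.
    have hrad : q.radical = p := by
      have h1 : q.radical ≤ p := (hp p hpt).radical_le_iff.2 hqp
      obtain ⟨p', hp', h2⟩ := (Ideal.isPrime_radical hqprim).inf_le'.1
        ((hle q hq).trans Ideal.le_radical)
      have : p' = p := hinc p' hp' p hpt (le_trans h2 h1)
      exact le_antisymm h1 (this ▸ h2)
    suffices p ≤ q by rwa [le_antisymm this hqp]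
    intro f hf
    -- `g` lies in every other member of `t` but not in `p = q.radical`, so `f * g ∈ q` forces `f ∈
    -- q`.
    obtain ⟨g, hg, hgp⟩ := SetLike.not_le_iff_exists.1
      ((isMinimalPrimaryDecomposition_inf_of_isPrime hp hinc).minimal hpt)
    have hfg : f * g ∈ t.inf id := by
      rw [Submodule.mem_finsetInf]
      intro p' hp'
      by_cases h : p' = p
      · exact h ▸ p.mul_mem_right g hf
      · exact Ideal.mul_mem_left _ _
          ((Submodule.mem_finsetInf.1 hg) p' (Finset.mem_erase.2 ⟨h, hp'⟩))
    exact ((Ideal.isPrimary_iff.1 hqprim).2 (hle q hq hfg)).resolve_right (hrad ▸ hgp)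
  refine Finset.Subset.antisymm (fun q hq => ?_) hsub
  by_contra hqt
  refine ht'.minimal hq (le_trans (Finset.inf_mono fun p hpt => ?_) (hle q hq))
  exact Finset.mem_erase.2 ⟨fun h => hqt (h ▸ hpt), hsub hpt⟩

theorem two_le_ringKrullDim_quotient {R : Type*} [CommRing R] {I p q m : Ideal R}
    (hp : p.IsPrime) (hq : q.IsPrime) (hm : m.IsPrime) (hIp : I ≤ p) (hpq : p < q) (hqm : q < m) :
    2 ≤ ringKrullDim (R ⧸ I) := by
  rw [ringKrullDim_quotient]
  let z (P : Ideal R) (hP : P.IsPrime) (h : I ≤ P) : PrimeSpectrum.zeroLocus (I : Set R) :=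
    ⟨⟨P, hP⟩, h⟩
  refine (Order.le_krullDim_iff (n := 2)).2
    ⟨⟨2, ![z p hp hIp, z q hq (hIp.trans hpq.le), z m hm (hIp.trans (hpq.trans hqm).le)],
      fun i => ?_⟩, rfl⟩
  fin_cases i
  · exact hpq
  · exact hqm

/-- `X ^ n - 1` is separable as `n ≠ 0` in `K`, so it has `n` distinct roots. -/
theorem exists_isPrimitiveRoot_of_splits {K : Type*} [Field K] {n : ℕ} (hn : (n : K) ≠ 0)
    (hs : (Polynomial.X ^ n - 1 : Polynomial K).Splits) : ∃ ζ : K, IsPrimitiveRoot ζ n := by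
  have hn0 : n ≠ 0 := by rintro rfl; simp at hn
  have : NeZero n := ⟨hn0⟩
  rw [← card_rootsOfUnity_eq_iff_exists_isPrimitiveRoot,
    Nat.card_congr (rootsOfUnityEquivNthRoots K n)]
  have hnodup := Polynomial.nodup_roots (Polynomial.X_pow_sub_one_separable_iff.2 hn)
  have hcard := hs.natDegree_eq_card_roots
  rw [← Polynomial.C_1, Polynomial.natDegree_X_pow_sub_C] at hcard
  rw [← Polynomial.C_1] at hnodup
  classical
  conv_rhs => rw [hcard, ← Multiset.toFinset_card_of_nodup hnodup]
  rw [← Fintype.card_coe, ← Nat.card_eq_fintype_card]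
  exact Nat.card_congr (Equiv.subtypeEquivRight fun x => Multiset.mem_toFinset.symm)

/-! ### Grading and rank -/

theorem cast_weight {s : ℕ} (d : Fin s → ℕ) (u : Fin s →₀ ℕ) :
    ((Finsupp.weight d u : ℕ) : ℤ) = (fun j => (d j : ℤ)) ⬝ᵥ fun j => (u j : ℤ) := by
  rw [Finsupp.weight_apply, Finsupp.sum_fintype _ _ (by simp)]
  simp [dotProduct, mul_comm]

theorem expPos_sub_expPos_neg {s : ℕ} (a : Fin s → ℤ) :
    ((fun j => (expPos a j : ℤ)) - fun j => (expPos (-a) j : ℤ)) = a := by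
  ext j
  simp [expPos]

theorem weight_sub_weight {s : ℕ} (d : Fin s → ℕ) (a : Fin s → ℤ) :
    ((Finsupp.weight d (expPos a) : ℕ) : ℤ) - (Finsupp.weight d (expPos (-a)) : ℕ) =
      (fun j => (d j : ℤ)) ⬝ᵥ a := by
  rw [cast_weight, cast_weight, ← dotProduct_sub, expPos_sub_expPos_neg]

theorem weight_eq_weight_iff {s : ℕ} (d : Fin s → ℕ) (a : Fin s → ℤ) :
    Finsupp.weight d (expPos a) = Finsupp.weight d (expPos (-a)) ↔
      (fun j => (d j : ℤ)) ⬝ᵥ a = 0 := by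
  rw [← weight_sub_weight, sub_eq_zero, Nat.cast_inj]

theorem prod_pow_eq_pow_weight {M : Type*} [CommMonoid M] {s : ℕ} (x : M) (d : Fin s → ℕ)
    (u : Fin s →₀ ℕ) : (u.prod fun j k => (x ^ d j) ^ k) = x ^ Finsupp.weight d u := by
  rw [Finsupp.weight_apply, Finsupp.sum, Finsupp.prod, ← Finset.prod_pow_eq_pow_sum]
  simp [mul_comm, ← pow_mul]

theorem dotProduct_eq_zero_of_isGradedFor {K : Type*} [Field K] {s : ℕ}
    {𝓛 : AddSubgroup (Fin s → ℤ)} {d : Fin s → ℕ} (h : IsGradedFor d (latticeIdeal K 𝓛))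
    {a : Fin s → ℤ} (ha : a ∈ 𝓛) : (fun j => (d j : ℤ)) ⬝ᵥ a = 0 := by
  rw [← weight_eq_weight_iff]
  by_contra hne
  let := weightedGradedAlgebra K d
  have hf : (monomial (expPos a) 1 - monomial (expPos (-a)) 1 : MvPolynomial (Fin s) K) ∈
      latticeIdeal K 𝓛 := Ideal.subset_span ⟨a, ha, rfl⟩
  have hmem := h (Finsupp.weight d (expPos a)) hf
  change ((weightedDecomposition K d).decompose' _ _ : MvPolynomial (Fin s) K) ∈ _ at hmem
  rw [weightedDecomposition.decompose'_apply, map_sub,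
    weightedHomogeneousComponent_of_mem
      (isWeightedHomogeneous_monomial d (expPos a) (1 : K) rfl),
    weightedHomogeneousComponent_of_mem
      (isWeightedHomogeneous_monomial d (expPos (-a)) (1 : K) rfl),
    if_pos rfl, if_neg hne, sub_zero] at hmem
  -- Lattice binomials vanish at `(1, …, 1)`, whereas the isolated monomial does not.
  have hle : latticeIdeal K 𝓛 ≤
      RingHom.ker (aeval (fun _ => 1) : MvPolynomial (Fin s) K →ₐ[K] K) := by
    rw [latticeIdeal, Ideal.span_le]
    rintro _ ⟨b, -, rfl⟩
    simp [RingHom.mem_ker, eval_monomial]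
  simpa [RingHom.mem_ker, eval_monomial] using hle hmem

/-- Two independent nonnegative linear forms vanishing on the lattice make the quotient by the
lattice ideal at least two-dimensional. -/
theorem two_le_ringKrullDim_of_independent {K : Type*} [Field K] {s : ℕ}
    {𝓛 : AddSubgroup (Fin s → ℤ)} (d e : Fin s → ℕ) (hd : ∀ j, 0 < d j)
    (hd𝓛 : ∀ a ∈ 𝓛, (fun j => (d j : ℤ)) ⬝ᵥ a = 0)
    (he𝓛 : ∀ a ∈ 𝓛, (fun j => (e j : ℤ)) ⬝ᵥ a = 0)
    (u : Fin s → ℤ) (hdu : (fun j => (d j : ℤ)) ⬝ᵥ u = 0)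
    (heu : (fun j => (e j : ℤ)) ⬝ᵥ u ≠ 0) :
    2 ≤ ringKrullDim (MvPolynomial (Fin s) K ⧸ latticeIdeal K 𝓛) := by
  -- `t_j ↦ x^{d_j} y^{e_j}`; setting `y = 1`, then `x = 0`, enlarges the kernel strictly, first by
  -- the binomial of `u`, then by a variable.
  let ψ : MvPolynomial (Fin s) K →ₐ[K] Polynomial (Polynomial K) :=
    aeval fun j => (Polynomial.C Polynomial.X) ^ d j * Polynomial.X ^ e j
  have hψ (v : Fin s →₀ ℕ) : ψ (monomial v 1) =
      Polynomial.monomial (Finsupp.weight e v) (Polynomial.X ^ Finsupp.weight d v) := by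
    simp only [ψ, aeval_monomial, map_one, one_mul, mul_pow]
    rw [Finsupp.prod_mul, prod_pow_eq_pow_weight, prod_pow_eq_pow_weight,
      ← Polynomial.C_mul_X_pow_eq_monomial, map_pow]
  let ψ₁ : MvPolynomial (Fin s) K →+* Polynomial K :=
    (Polynomial.evalRingHom 1).comp ψ.toRingHom
  have hψ₁ (v : Fin s →₀ ℕ) : ψ₁ (monomial v 1) = Polynomial.X ^ Finsupp.weight d v := by
    simp [ψ₁, hψ]
  let ψ₀ : MvPolynomial (Fin s) K →+* K := (Polynomial.evalRingHom 0).comp ψ₁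
  have hs : 0 < s := by
    rcases Nat.eq_zero_or_pos s with rfl | h
    · simp at heu
    · exact h
  refine two_le_ringKrullDim_quotient (p := RingHom.ker ψ) (q := RingHom.ker ψ₁)
    (m := RingHom.ker ψ₀) (RingHom.ker_isPrime _) (RingHom.ker_isPrime _) (RingHom.ker_isPrime _)
    ?_ (lt_of_le_not_ge ?_ fun h => ?_) (lt_of_le_not_ge ?_ fun h => ?_)
  · rw [latticeIdeal, Ideal.span_le]
    rintro _ ⟨a, ha, rfl⟩
    rw [SetLike.mem_coe, RingHom.mem_ker, map_sub, hψ, hψ,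
      (weight_eq_weight_iff d a).2 (hd𝓛 a ha), (weight_eq_weight_iff e a).2 (he𝓛 a ha), sub_self]
  · intro f hf
    have : ψ f = 0 := hf
    simp [RingHom.mem_ker, ψ₁, this]
  · have h1 : (monomial (expPos u) 1 - monomial (expPos (-u)) 1 : MvPolynomial (Fin s) K) ∈
        RingHom.ker ψ₁ := by
      rw [RingHom.mem_ker, map_sub, hψ₁, hψ₁, (weight_eq_weight_iff d u).2 hdu, sub_self]
    have h2 := h h1
    rw [RingHom.mem_ker, map_sub, hψ, hψ, sub_eq_zero] at h2
    have h3 := congrArg (fun p => Polynomial.coeff p (Finsupp.weight e (expPos u))) h2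
    have hne := mt (weight_eq_weight_iff e u).1 heu
    simp [Polynomial.coeff_monomial, Ne.symm hne] at h3
  · intro f hf
    have : ψ₁ f = 0 := hf
    simp [RingHom.mem_ker, ψ₀, this]
  · have h1 : (monomial (Finsupp.single ⟨0, hs⟩ 1) 1 : MvPolynomial (Fin s) K) ∈
        RingHom.ker ψ₀ := by
      rw [RingHom.mem_ker]
      simp only [ψ₀, RingHom.comp_apply, hψ₁]
      simp [Finsupp.weight_single, (hd _).ne']
    have h2 := h h1
    rw [RingHom.mem_ker, hψ₁] at h2
    exact pow_ne_zero _ Polynomial.X_ne_zero h2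

theorem IsNormalDecomposition.rank_add_one_eq {K : Type*} [Field K] {s m r : ℕ}
    {L : Matrix (Fin s) (Fin m) ℤ} {P : Matrix (Fin s) (Fin s) ℤ} {Q : Matrix (Fin m) (Fin m) ℤ}
    {γ : Fin r → ℕ} (hN : IsNormalDecomposition L P Q γ) (hs : 0 < s)
    {d : Fin s → ℕ} (hd : ∀ i, 0 < d i)
    (hd𝓛 : ∀ a ∈ AddSubgroup.closure (Set.range L.col), (fun j => (d j : ℤ)) ⬝ᵥ a = 0)
    (hdim : ringKrullDim
      (MvPolynomial (Fin s) K ⧸ latticeIdeal K (AddSubgroup.closure (Set.range L.col))) = 1) :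
    r + 1 = s := by
  have hle := hN.le_rows
  by_contra hne
  rcases Nat.lt_or_ge r s with hlt | hge
  · obtain ⟨e, u, he, hdu, heu⟩ := hN.exists_independent (by omega) _ hd𝓛
    -- Adding `N * d` makes `e` nonnegative, and changes neither its values on the lattice nor `e ⬝ᵥ
    -- u`, since `d` vanishes there.
    let N : ℕ := ∑ j, (e j).natAbs
    have hnonneg (j) : 0 ≤ e j + N * d j := by
      have h1 : (e j).natAbs ≤ N :=
        Finset.single_le_sum (f := fun j => (e j).natAbs) (by simp) (Finset.mem_univ j)
      have h2 : N ≤ N * d j := Nat.le_mul_of_pos_right _ (hd j)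
      have : (N : ℤ) ≤ N * d j := by exact_mod_cast h2
      omega
    have hcast : (fun j => (((e j + N * d j).toNat : ℕ) : ℤ)) =
        e + (N : ℤ) • fun j => (d j : ℤ) := by
      ext j
      simp [Int.toNat_of_nonneg (hnonneg j)]
    have h2 := two_le_ringKrullDim_of_independent (K := K) d (fun j => (e j + N * d j).toNat) hd
      hd𝓛 (fun a ha => by rw [hcast, add_dotProduct, smul_dotProduct, he a ha, hd𝓛 a ha]; simp)
      u hdu (by rw [hcast, add_dotProduct, smul_dotProduct, hdu]; simpa using heu)
    rw [hdim] at h2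
    exact absurd h2 (by decide)
  · obtain ⟨c, hc, hdc⟩ := hN.exists_coeff _ hd𝓛
    have h0 : c = 0 := funext fun i => hc i (by omega)
    have := hdc (Pi.single ⟨0, hs⟩ 1)
    simp [h0] at this
    exact (hd _).ne' this

/-! ### Characters and the intersection formula -/

/-- The character `a ↦ ∏ i, λ_i ^ (P a)_i` of `ℤ^s`. -/
def latticeChar {K : Type*} [Field K] {s r : ℕ} (hrs : r ≤ s) (P : Matrix (Fin s) (Fin s) ℤ)
    {γ : Fin r → ℕ} (lam : (i : Fin r) → rootsOfUnity (γ i) K) (a : Fin s → ℤ) : Kˣ :=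
  ∏ i : Fin r, (lam i : Kˣ) ^ (P *ᵥ a) (Fin.castLE hrs i)

/-- The exponent vector `u` as an element of `ℤ^s`. -/
def intVec {s : ℕ} (u : Fin s →₀ ℕ) : Fin s → ℤ := fun j => u j

theorem latticeChar_sub {K : Type*} [Field K] {s r : ℕ} (hrs : r ≤ s)
    (P : Matrix (Fin s) (Fin s) ℤ) {γ : Fin r → ℕ} (lam : (i : Fin r) → rootsOfUnity (γ i) K)
    (a b : Fin s → ℤ) :
    latticeChar hrs P lam (a - b) = latticeChar hrs P lam a / latticeChar hrs P lam b := by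
  simp [latticeChar, mulVec_sub, _root_.zpow_sub, Finset.prod_mul_distrib, Finset.prod_inv_distrib,
    div_eq_mul_inv]

theorem zpow_finsetSum {G ι : Type*} [CommGroup G] (g : G) (t : Finset ι) (n : ι → ℤ) :
    g ^ ∑ j ∈ t, n j = ∏ j ∈ t, g ^ n j := by
  classical
  induction t using Finset.induction_on with
  | empty => simp
  | insert j t hj ih => rw [Finset.sum_insert hj, Finset.prod_insert hj, _root_.zpow_add, ih]

theorem phi_monomial {K : Type*} [Field K] {s r : ℕ} (hrs : r ≤ s)
    (P : Matrix (Fin s) (Fin s) ℤ) (d : Fin s → ℕ) {γ : Fin r → ℕ}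
    (lam : (i : Fin r) → rootsOfUnity (γ i) K) (u : Fin s →₀ ℕ) (k : K) :
    phi hrs P d lam (monomial u k) =
      Polynomial.monomial (Finsupp.weight d u) (k * latticeChar hrs P lam (intVec u)) := by
  have hχ : (u.prod fun j n => (∏ i : Fin r, (lam i : Kˣ) ^ P (Fin.castLE hrs i) j) ^ n) =
      latticeChar hrs P lam (intVec u) := by
    rw [Finsupp.prod_fintype _ _ (by simp)]
    simp only [latticeChar, ← Finset.prod_pow]
    rw [Finset.prod_comm]
    refine Finset.prod_congr rfl fun i _ => ?_
    simp only [mulVec, dotProduct, intVec]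
    rw [zpow_finsetSum]
    exact Finset.prod_congr rfl fun j _ => by rw [_root_.zpow_mul, zpow_natCast]
  simp only [phi, aeval_monomial, mul_pow]
  rw [Finsupp.prod_mul, prod_pow_eq_pow_weight, ← Polynomial.C_mul_X_pow_eq_monomial, ← hχ]
  simp [Finsupp.prod, mul_assoc]

/-- The case `k = 1` places lattice binomials in each kernel; other `k` separate the kernels. -/
theorem monomial_sub_monomial_mem_aIdeal_iff {K : Type*} [Field K] {s r : ℕ} (hrs : r ≤ s)
    (P : Matrix (Fin s) (Fin s) ℤ) (d : Fin s → ℕ) {γ : Fin r → ℕ}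
    (lam : (i : Fin r) → rootsOfUnity (γ i) K) {a : Fin s → ℤ}
    (ha : (fun j => (d j : ℤ)) ⬝ᵥ a = 0) (k : K) :
    monomial (expPos a) 1 - monomial (expPos (-a)) k ∈ aIdeal hrs P d lam ↔
      (latticeChar hrs P lam a : K) = k := by
  rw [aIdeal, RingHom.mem_ker, map_sub, phi_monomial, phi_monomial,
    (weight_eq_weight_iff d a).2 ha, ← Polynomial.monomial_sub, Polynomial.monomial_eq_zero_iff,
    sub_eq_zero, one_mul]
  have h := latticeChar_sub hrs P lam (intVec (expPos a)) (intVec (expPos (-a)))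
  have h' : intVec (expPos a) - intVec (expPos (-a)) = a := expPos_sub_expPos_neg a
  rw [h'] at h
  rw [h, Units.val_div_eq_div_val, div_eq_iff (Units.ne_zero _)]

theorem latticeChar_eq_one {K : Type*} [Field K] {s r : ℕ} (hrs : r ≤ s)
    (P : Matrix (Fin s) (Fin s) ℤ) {γ : Fin r → ℕ} (lam : (i : Fin r) → rootsOfUnity (γ i) K)
    {a : Fin s → ℤ} (ha : ∀ i, (γ i : ℤ) ∣ (P *ᵥ a) (Fin.castLE hrs i)) :
    latticeChar hrs P lam a = 1 := by
  refine Finset.prod_eq_one fun i _ => ?_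
  obtain ⟨k, hk⟩ := ha i
  rw [hk, _root_.zpow_mul, zpow_natCast, (mem_rootsOfUnity _ _).1 (lam i).2, _root_.one_zpow]

theorem sum_latticeChar_eq_zero {K : Type*} [Field K] {s r : ℕ} (hrs : r ≤ s)
    (P : Matrix (Fin s) (Fin s) ℤ) {γ : Fin r → ℕ}
    [Fintype ((i : Fin r) → rootsOfUnity (γ i) K)] [∀ i, NeZero (γ i)]
    (hγ : ∀ i, ∃ ζ : K, IsPrimitiveRoot ζ (γ i)) {a : Fin s → ℤ}
    (ha : ¬ ∀ i, (γ i : ℤ) ∣ (P *ᵥ a) (Fin.castLE hrs i)) :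
    ∑ lam : (i : Fin r) → rootsOfUnity (γ i) K, (latticeChar hrs P lam a : K) = 0 := by
  obtain ⟨i, hi⟩ := not_forall.1 ha
  obtain ⟨ζ, hζ⟩ := hγ i
  let f : ((i : Fin r) → rootsOfUnity (γ i) K) →* K :=
    { toFun := fun lam => (latticeChar hrs P lam a : K)
      map_one' := by simp [latticeChar]
      map_mul' := fun x y => by simp [latticeChar, mul_zpow, Finset.prod_mul_distrib] }
  refine sum_hom_units_eq_zero f fun hf => hi ?_
  -- Testing a trivial character on `ζ` in slot `i` gives `ζ ^ (P a)_i = 1`.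
  have h : latticeChar hrs P (Pi.mulSingle i hζ.toRootsOfUnity) a = 1 :=
    Units.ext (DFunLike.congr_fun hf (Pi.mulSingle i hζ.toRootsOfUnity))
  rw [latticeChar, Finset.prod_eq_single i (fun j _ hj => by simp [Pi.mulSingle_eq_of_ne hj])
    (by simp), Pi.mulSingle_eq_same] at h
  rw [← hζ.zpow_eq_one_iff_dvd]
  simpa using congrArg (Units.val) h

theorem monomial_sub_monomial_mem_latticeIdeal (K : Type*) [Field K] {s : ℕ}
    {𝓛 : AddSubgroup (Fin s → ℤ)} {u v : Fin s →₀ ℕ} (h : intVec u - intVec v ∈ 𝓛) :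
    (monomial u 1 - monomial v 1 : MvPolynomial (Fin s) K) ∈ latticeIdeal K 𝓛 := by
  -- Truncated subtraction yields `min u v`, the common monomial factor.
  have hu : u = (u - expPos (intVec u - intVec v)) + expPos (intVec u - intVec v) := by
    ext j; simp [expPos, intVec]
  have hv : v = (u - expPos (intVec u - intVec v)) + expPos (-(intVec u - intVec v)) := by
    ext j; simp [expPos, intVec]; omega
  have : (monomial u 1 - monomial v 1 : MvPolynomial (Fin s) K) =
      monomial (u - expPos (intVec u - intVec v)) 1 *
        (monomial (expPos (intVec u - intVec v)) 1 -
          monomial (expPos (-(intVec u - intVec v))) 1) := by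
    rw [mul_sub, monomial_mul, monomial_mul, ← hu, ← hv, one_mul]
  rw [this]
  exact Ideal.mul_mem_left _ _ (Ideal.subset_span ⟨_, h, rfl⟩)

/-- A polynomial whose coefficients sum to zero over each class of exponents modulo the lattice
lies in the lattice ideal. -/
theorem mem_latticeIdeal_of_sum_coeff_eq_zero {K : Type*} [Field K] {s : ℕ}
    {𝓛 : AddSubgroup (Fin s → ℤ)} [DecidablePred (· ∈ 𝓛)] {f : MvPolynomial (Fin s) K}
    (h : ∀ v, ∑ u ∈ f.support with intVec u - intVec v ∈ 𝓛, f.coeff u = 0) :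
    f ∈ latticeIdeal K 𝓛 := by
  classical
  rw [← Ideal.Quotient.eq_zero_iff_mem]
  let cl : (Fin s →₀ ℕ) → (Fin s → ℤ) ⧸ 𝓛 := fun u => QuotientAddGroup.mk (intVec u)
  have hcl (u v) : cl u = cl v ↔ intVec u - intVec v ∈ 𝓛 := by
    rw [← neg_mem_iff, neg_sub, sub_eq_neg_add, ← QuotientAddGroup.eq]
  have hmk (u : Fin s →₀ ℕ) (k : K) : Ideal.Quotient.mk (latticeIdeal K 𝓛) (monomial u k) =
      k • Ideal.Quotient.mk (latticeIdeal K 𝓛) (monomial u 1) := by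
    rw [← Ideal.Quotient.mkₐ_eq_mk K, ← map_smul, smul_monomial, smul_eq_mul, mul_one]
  conv_lhs => rw [f.as_sum, map_sum]
  rw [← Finset.sum_fiberwise_of_maps_to (g := cl) (t := f.support.image cl)
    (fun u hu => Finset.mem_image_of_mem _ hu)]
  refine Finset.sum_eq_zero fun g hg => ?_
  obtain ⟨v, -, rfl⟩ := Finset.mem_image.1 hg
  have : ∀ u ∈ f.support.filter (cl · = cl v),
      Ideal.Quotient.mk (latticeIdeal K 𝓛) (monomial u (f.coeff u)) =
        f.coeff u • Ideal.Quotient.mk (latticeIdeal K 𝓛) (monomial v 1) := by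
    intro u hu
    rw [hmk]
    congr 1
    rw [Ideal.Quotient.eq]
    exact monomial_sub_monomial_mem_latticeIdeal K ((hcl u v).1 (Finset.mem_filter.1 hu).2)
  rw [Finset.sum_congr rfl this, ← Finset.sum_smul]
  simp only [hcl]
  rw [h v, zero_smul]

/-- The orthogonality of characters gives the decomposition of the lattice ideal. -/
theorem latticeIdeal_eq_iInf {K : Type*} [Field K] {s r : ℕ} (hrs : r ≤ s)
    (P : Matrix (Fin s) (Fin s) ℤ) {γ : Fin r → ℕ} (hpos : ∀ i, 0 < γ i)
    (hγ : ∀ i, ∃ ζ : K, IsPrimitiveRoot ζ (γ i)) (hγK : ∀ i, (γ i : K) ≠ 0) (d : Fin s → ℕ)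
    {𝓛 : AddSubgroup (Fin s → ℤ)}
    (h𝓛 : ∀ a, a ∈ 𝓛 ↔ (fun j => (d j : ℤ)) ⬝ᵥ a = 0 ∧
      ∀ i, (γ i : ℤ) ∣ (P *ᵥ a) (Fin.castLE hrs i)) :
    latticeIdeal K 𝓛 =
      ⨅ lam : (i : Fin r) → rootsOfUnity (γ i) K, aIdeal hrs P d lam := by
  classical
  have : ∀ i, NeZero (γ i) := fun i => ⟨(hpos i).ne'⟩
  let := Fintype.ofFinite ((i : Fin r) → rootsOfUnity (γ i) K)
  refine le_antisymm (le_iInf fun lam => ?_) fun f hf => ?_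
  · rw [latticeIdeal, Ideal.span_le]
    rintro _ ⟨a, ha, rfl⟩
    exact (monomial_sub_monomial_mem_aIdeal_iff hrs P d lam ((h𝓛 a).1 ha).1 1).2
      (by rw [latticeChar_eq_one hrs P lam ((h𝓛 a).1 ha).2, Units.val_one])
  · refine mem_latticeIdeal_of_sum_coeff_eq_zero fun v => ?_
    have hcoeff (lam : (i : Fin r) → rootsOfUnity (γ i) K) :
        ∑ u ∈ f.support with Finsupp.weight d u = Finsupp.weight d v,
          f.coeff u * (latticeChar hrs P lam (intVec u - intVec v) : K) = 0 := by
      have h0 : phi hrs P d lam f = 0 := (Submodule.mem_iInf _).1 hf lam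
      rw [f.as_sum, map_sum] at h0
      -- Dividing by `χ_λ(v)` leaves characters of `u - v`.
      have h1 := congrArg (fun p => p.coeff (Finsupp.weight d v) *
        (latticeChar hrs P lam (intVec v) : K)⁻¹) h0
      simp only [phi_monomial, Polynomial.finsetSum_coeff, Polynomial.coeff_monomial,
        Polynomial.coeff_zero, zero_mul, Finset.sum_mul, ← Finset.sum_filter] at h1
      rw [← h1]
      refine Finset.sum_congr rfl fun u _ => ?_
      rw [latticeChar_sub, Units.val_div_eq_div_val, div_eq_mul_inv, mul_assoc]
    have hsum : ∑ u ∈ f.support with Finsupp.weight d u = Finsupp.weight d v,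
        f.coeff u * ∑ lam : (i : Fin r) → rootsOfUnity (γ i) K,
          (latticeChar hrs P lam (intVec u - intVec v) : K) = 0 := by
      simp only [Finset.mul_sum]
      rw [Finset.sum_comm]
      exact Finset.sum_eq_zero fun lam _ => hcoeff lam
    have hw (u) : Finsupp.weight d u = Finsupp.weight d v ↔
        (fun j => (d j : ℤ)) ⬝ᵥ (intVec u - intVec v) = 0 := by
      rw [dotProduct_sub, sub_eq_zero, ← @Nat.cast_inj ℤ, cast_weight, cast_weight]
      rfl
    have hterm (u) : (∑ lam : (i : Fin r) → rootsOfUnity (γ i) K,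
        (latticeChar hrs P lam (intVec u - intVec v) : K)) =
          if ∀ i, (γ i : ℤ) ∣ (P *ᵥ (intVec u - intVec v)) (Fin.castLE hrs i) then
            ((∏ i, γ i : ℕ) : K) else 0 := by
      split_ifs with h
      · have hcard : Fintype.card ((i : Fin r) → rootsOfUnity (γ i) K) = ∏ i, γ i := by
          rw [← Nat.card_eq_fintype_card, Nat.card_pi]
          refine Finset.prod_congr rfl fun i _ => ?_
          exact card_rootsOfUnity_eq_iff_exists_isPrimitiveRoot.2 (hγ i)
        simp only [latticeChar_eq_one hrs P _ h, Units.val_one, Finset.sum_const,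
          Finset.card_univ, hcard, nsmul_eq_mul, mul_one]
      · exact sum_latticeChar_eq_zero hrs P hγ h
    simp only [hterm, mul_ite, mul_zero, ← Finset.sum_filter, Finset.filter_filter, hw,
      ← h𝓛, ← Finset.sum_mul] at hsum
    refine (mul_eq_zero.1 hsum).resolve_right ?_
    rw [Nat.cast_prod]
    exact Finset.prod_ne_zero_iff.2 fun i _ => hγK i

/-! ### Torsion of the quotient -/

theorem AddEquiv.natCard_torsion_eq {G H : Type*} [AddCommGroup G] [AddCommGroup H] (e : G ≃+ H) :
    Nat.card (AddCommGroup.torsion G) = Nat.card (AddCommGroup.torsion H) :=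
  Nat.card_congr <| e.toEquiv.subtypeEquiv fun _ =>
    (e.injective.isOfFinAddOrder_iff (f := e.toAddMonoidHom)).symm

theorem natCard_torsion_prod_int (A : Type*) [AddCommGroup A] [Finite A] :
    Nat.card (AddCommGroup.torsion (A × ℤ)) = Nat.card A := by
  have h (x : A × ℤ) : x ∈ AddCommGroup.torsion (A × ℤ) ↔ x.2 = 0 := by
    rw [AddCommGroup.mem_torsion]
    constructor
    · intro hx
      exact (isOfFinAddOrder_iff_eq_zero _).1 ((AddMonoidHom.snd A ℤ).isOfFinAddOrder hx)
    · rintro hx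
      have := (AddMonoidHom.inl A ℤ).isOfFinAddOrder (isOfFinAddOrder_of_finite x.1)
      rwa [show x = AddMonoidHom.inl A ℤ x.1 from Prod.ext rfl hx]
  exact Nat.card_congr
    { toFun := fun x => x.1.1
      invFun := fun a => ⟨(a, 0), (h _).2 rfl⟩
      left_inv := fun x => Subtype.ext (Prod.ext rfl ((h _).1 x.2).symm)
      right_inv := fun _ => rfl }

theorem IsNormalDecomposition.natCard_torsion {s m r : ℕ} {L : Matrix (Fin s) (Fin m) ℤ}
    {P : Matrix (Fin s) (Fin s) ℤ} {Q : Matrix (Fin m) (Fin m) ℤ} {γ : Fin r → ℕ}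
    (hN : IsNormalDecomposition L P Q γ) (hr : r + 1 = s) :
    Nat.card (AddCommGroup.torsion ((Fin s → ℤ) ⧸ AddSubgroup.closure (Set.range L.col))) =
      ∏ i, γ i := by
  subst hr
  have : ∀ i, NeZero (γ i) := fun i => ⟨(hN.pos i).ne'⟩
  -- `θ` induces `ℤ^s/𝓛 ≃ ∏ ℤ/γ_i × ℤ`, the free factor being the last coordinate.
  let θ : (Fin (r + 1) → ℤ) →+ ((i : Fin r) → ZMod (γ i)) × ℤ :=
    { toFun := fun a => (fun i => ((P *ᵥ a) (Fin.castLE hN.le_rows i) : ZMod (γ i)),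
        (P *ᵥ a) (Fin.last r))
      map_zero' := by ext <;> simp
      map_add' := fun a b => by ext <;> simp [mulVec_add] }
  have hθ : Function.Surjective θ := by
    rintro ⟨x, n⟩
    refine ⟨P⁻¹ *ᵥ (Fin.snoc (fun i => (x i).cast : Fin r → ℤ) n : Fin (r + 1) → ℤ), ?_⟩
    have hc (i : Fin r) : Fin.castLE hN.le_rows i = i.castSucc := rfl
    simp only [θ, AddMonoidHom.coe_mk, ZeroHom.coe_mk, hN.mulVec_inv_mulVec, hc]
    ext <;> simp
  have hker : θ.ker = AddSubgroup.closure (Set.range L.col) := by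
    ext a
    rw [hN.mem_closure_iff, AddMonoidHom.mem_ker, Prod.ext_iff, _root_.funext_iff]
    refine and_congr (forall_congr' fun i => ZMod.intCast_zmod_eq_zero_iff_dvd _ _) ?_
    constructor
    · intro h i hi
      rwa [show i = Fin.last r from Fin.ext (by simp; omega)]
    · intro h
      exact h _ le_rfl
  rw [← hker, (QuotientAddGroup.quotientKerEquivOfSurjective θ hθ).natCard_torsion_eq,
    natCard_torsion_prod_int, Nat.card_pi]
  simp

/-! ### Corank one, distinct kernels and the theorem -/

/-- In corank one `d` is a nonzero multiple of the last row of `P`. -/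
theorem IsNormalDecomposition.mem_closure_iff_dotProduct {s m r : ℕ}
    {L : Matrix (Fin s) (Fin m) ℤ}
    {P : Matrix (Fin s) (Fin s) ℤ} {Q : Matrix (Fin m) (Fin m) ℤ} {γ : Fin r → ℕ}
    (hN : IsNormalDecomposition L P Q γ) (hr : r + 1 = s) {d : Fin s → ℤ} (hd : d ≠ 0)
    (hd𝓛 : ∀ a ∈ AddSubgroup.closure (Set.range L.col), d ⬝ᵥ a = 0) (a : Fin s → ℤ) :
    a ∈ AddSubgroup.closure (Set.range L.col) ↔
      d ⬝ᵥ a = 0 ∧ ∀ i : Fin r, (γ i : ℤ) ∣ (P *ᵥ a) (Fin.castLE hN.le_rows i) := by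
  subst hr
  refine ⟨fun ha => ⟨hd𝓛 a ha, ((hN.mem_closure_iff a).1 ha).1⟩, fun ⟨h0, h⟩ =>
    (hN.mem_closure_iff a).2 ⟨h, fun i hi => ?_⟩⟩
  obtain ⟨c, hc, hdc⟩ := hN.exists_coeff d hd𝓛
  have hlast (b : Fin (r + 1) → ℤ) : d ⬝ᵥ b = c (Fin.last r) * (P *ᵥ b) (Fin.last r) := by
    rw [hdc, dotProduct, Finset.sum_eq_single (Fin.last r) _ (by simp)]
    intro j _ hj
    rw [hc j (by have := Fin.val_ne_of_ne hj; simp at this; omega), zero_mul]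
  rw [show i = Fin.last r from Fin.ext (by simp; omega)]
  rw [hlast] at h0
  refine (mul_eq_zero.1 h0).resolve_left fun hc0 => hd ?_
  ext j
  simpa [hc0] using hlast (Pi.single j 1)

theorem IsNormalDecomposition.eq_of_aIdeal_le {K : Type*} [Field K] {s m r : ℕ}
    {L : Matrix (Fin s) (Fin m) ℤ}
    {P : Matrix (Fin s) (Fin s) ℤ} {Q : Matrix (Fin m) (Fin m) ℤ} {γ : Fin r → ℕ}
    (hN : IsNormalDecomposition L P Q γ) {d : Fin s → ℕ}
    (hd𝓛 : ∀ a ∈ AddSubgroup.closure (Set.range L.col), (fun j => (d j : ℤ)) ⬝ᵥ a = 0)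
    {lam mu : (i : Fin r) → rootsOfUnity (γ i) K}
    (h : aIdeal hN.le_rows P d lam ≤ aIdeal hN.le_rows P d mu) : lam = mu := by
  funext i
  -- `P w = e_i`, so the character of `ν` at `w` reads off `ν i`.
  set w : Fin s → ℤ := P⁻¹ *ᵥ Pi.single (Fin.castLE hN.le_rows i) 1 with hw
  have hdw : (fun j => (d j : ℤ)) ⬝ᵥ w = 0 := by
    obtain ⟨c, hc, hdc⟩ := hN.exists_coeff _ hd𝓛
    rw [hdc, hw, hN.mulVec_inv_mulVec]
    simp [hc]
  have hchar (nu : (i : Fin r) → rootsOfUnity (γ i) K) :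
      latticeChar hN.le_rows P nu w = nu i := by
    rw [latticeChar, hw, hN.mulVec_inv_mulVec, Finset.prod_eq_single i _ (by simp)]
    · simp
    · intro j _ hj
      rw [Pi.single_eq_of_ne (fun h => hj (Fin.castLE_injective _ h)), zpow_zero]
  have h1 := h ((monomial_sub_monomial_mem_aIdeal_iff hN.le_rows P d lam hdw _).2 rfl)
  rw [monomial_sub_monomial_mem_aIdeal_iff hN.le_rows P d mu hdw, hchar, hchar] at h1
  exact Subtype.ext (Units.ext h1.symm)

/-- Each `γ i` divides the last one, so powers of a single primitive root suffice. -/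
theorem exists_isPrimitiveRoot_of_chain {K : Type*} [Field K] {r : ℕ} {γ : Fin r → ℕ}
    (hdvd : ∀ i j, i ≤ j → γ i ∣ γ j) (hpos : ∀ i, 0 < γ i)
    (hroots : ∀ i : Fin r, (i : ℕ) + 1 = r →
      (Polynomial.X ^ γ i - 1 : Polynomial K).Splits)
    (hchar : ∀ i : Fin r, (i : ℕ) + 1 = r → ¬ ringChar K ∣ γ i) (i : Fin r) :
    (γ i : K) ≠ 0 ∧ ∃ ζ : K, IsPrimitiveRoot ζ (γ i) := by
  have hi := i.isLt
  let l : Fin r := ⟨r - 1, by omega⟩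
  have hl : (l : ℕ) + 1 = r := Nat.sub_add_cancel (by omega)
  have hil : γ i ∣ γ l := hdvd i l (Fin.le_def.2 (by omega))
  have hlK : (γ l : K) ≠ 0 := fun h => hchar l hl ((ringChar.spec K _).1 h)
  obtain ⟨k, hk⟩ := hil
  refine ⟨fun h => hlK (by rw [hk, Nat.cast_mul, h, zero_mul]), ?_⟩
  obtain ⟨ζ, hζ⟩ := exists_isPrimitiveRoot_of_splits hlK (hroots l hl)
  exact ⟨ζ ^ k, hζ.pow (hpos l) (by rw [hk, mul_comm])⟩

end

theorem theorem3p3 {K : Type*} [Field K] {s m r : ℕ}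
    (𝓛 : AddSubgroup (Fin s → ℤ)) (L : Matrix (Fin s) (Fin m) ℤ)
    (h𝓛 : 𝓛 = AddSubgroup.closure (Set.range L.col))
    (P : Matrix (Fin s) (Fin s) ℤ) (Q : Matrix (Fin m) (Fin m) ℤ) (γ : Fin r → ℕ)
    (hN : IsNormalDecomposition L P Q γ)
    (d : Fin s → ℕ) (hd : ∀ i, 0 < d i) (hgcd : Finset.univ.gcd d = 1)
    (hgraded : IsGradedFor d (latticeIdeal K 𝓛))
    (hdim : ringKrullDim (MvPolynomial (Fin s) K ⧸ latticeIdeal K 𝓛) = 1)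
    -- the largest invariant factor `γ_r` (the last one; no condition if `r = 0`)
    (hroots : ∀ i : Fin r, (i : ℕ) + 1 = r →
      (Polynomial.X ^ γ i - 1 : Polynomial K).Splits)
    (hchar : ∀ i : Fin r, (i : ℕ) + 1 = r → ¬ ringChar K ∣ γ i) :
    r + 1 = s ∧
    (∀ lam : (i : Fin r) → rootsOfUnity (γ i) K, (aIdeal hN.le_rows P d lam).IsPrime) ∧
    Function.Injective
      (fun lam : (i : Fin r) → rootsOfUnity (γ i) K => aIdeal hN.le_rows P d lam) ∧
    latticeIdeal K 𝓛 =
      ⨅ lam : (i : Fin r) → rootsOfUnity (γ i) K, aIdeal hN.le_rows P d lam ∧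
    ∏ i, γ i = Nat.card (AddCommGroup.torsion ((Fin s → ℤ) ⧸ 𝓛)) ∧
    -- the family `𝔞_λ` is the unique minimal primary decomposition, and has `γ` members
    ∃ t : Finset (Ideal (MvPolynomial (Fin s) K)),
      (t : Set (Ideal (MvPolynomial (Fin s) K))) =
        Set.range (fun lam : (i : Fin r) → rootsOfUnity (γ i) K =>
          aIdeal hN.le_rows P d lam) ∧
      t.card = ∏ i, γ i ∧
      Submodule.IsMinimalPrimaryDecomposition (latticeIdeal K 𝓛) t ∧
      ∀ t' : Finset (Ideal (MvPolynomial (Fin s) K)),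
        Submodule.IsMinimalPrimaryDecomposition (latticeIdeal K 𝓛) t' → t' = t := by
  subst h𝓛
  have hd𝓛 := fun a ha => dotProduct_eq_zero_of_isGradedFor hgraded (a := a) ha
  -- The gcd of an empty family is `0`, not `1`.
  have hs : 0 < s := by
    rcases Nat.eq_zero_or_pos s with rfl | h
    · simp at hgcd
    · exact h
  have hr : r + 1 = s := hN.rank_add_one_eq hs hd hd𝓛 hdim
  have hγ := exists_isPrimitiveRoot_of_chain hN.dvd hN.pos hroots hchar
  have hprime (lam : (i : Fin r) → rootsOfUnity (γ i) K) :
      (aIdeal hN.le_rows P d lam).IsPrime := RingHom.ker_isPrime _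
  have hinj : Function.Injective
      (fun lam : (i : Fin r) → rootsOfUnity (γ i) K => aIdeal hN.le_rows P d lam) :=
    fun lam mu h => hN.eq_of_aIdeal_le hd𝓛 (le_of_eq h)
  have hd0 : (fun j => (d j : ℤ)) ≠ 0 := fun h =>
    (hd ⟨0, hs⟩).ne' (by simpa using congrFun h ⟨0, hs⟩)
  have hI := latticeIdeal_eq_iInf hN.le_rows P hN.pos (fun i => (hγ i).2) (fun i => (hγ i).1) d
    (hN.mem_closure_iff_dotProduct hr hd0 hd𝓛)
  refine ⟨hr, hprime, hinj, hI, (hN.natCard_torsion hr).symm, ?_⟩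
  classical
  have : ∀ i, NeZero (γ i) := fun i => ⟨(hN.pos i).ne'⟩
  let := Fintype.ofFinite ((i : Fin r) → rootsOfUnity (γ i) K)
  let t := Finset.univ.image
    (fun lam : (i : Fin r) → rootsOfUnity (γ i) K => aIdeal hN.le_rows P d lam)
  have htI : latticeIdeal K (AddSubgroup.closure (Set.range L.col)) = t.inf id := by
    rw [hI, Finset.inf_image, Finset.inf_univ_eq_iInf]
    rfl
  have hp : ∀ p ∈ t, p.IsPrime := by
    intro p hpt
    obtain ⟨lam, -, rfl⟩ := Finset.mem_image.1 hpt
    exact hprime lam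
  have hinc : ∀ p ∈ t, ∀ q ∈ t, p ≤ q → p = q := by
    intro p hpt q hqt hpq
    obtain ⟨lam, -, rfl⟩ := Finset.mem_image.1 hpt
    obtain ⟨mu, -, rfl⟩ := Finset.mem_image.1 hqt
    rw [hN.eq_of_aIdeal_le hd𝓛 hpq]
  refine ⟨t, by simp [t], ?_, ?_, fun t' ht' => ?_⟩
  · rw [Finset.card_image_of_injective _ hinj, Finset.card_univ, ← Nat.card_eq_fintype_card,
      Nat.card_pi]
    exact Finset.prod_congr rfl fun i _ =>
      card_rootsOfUnity_eq_iff_exists_isPrimitiveRoot.2 (hγ i).2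
  · rw [htI]
    exact isMinimalPrimaryDecomposition_inf_of_isPrime hp hinc
  · rw [htI] at ht'
    exact eq_of_isMinimalPrimaryDecomposition_inf hp hinc ht'
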